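/- Let $G$ be a finite undirected graph, possibly with self-loops and multiple edges. An orientation of an edge with ends $v,w$ is a choice of which end is its tail and which its head, so a self-loop has one orientation and every other edge has two; an orientation of $G$ is an orientation of each edge. A vertex is a sink of an orientation if it is not the tail of any edge. Let $X_{e,k}$ ($e$ an edge of $G$, $k\ge 0$ an integer) be independent random variables, with $X_{e,k}$ uniformly distributed on the orientations of $e$. Sink popping on $G$ runs as follows. Put $f(e,0)=0$ for every edge $e$. Given $f(\cdot,k)$, consider the orientation $(X_{e,f(e,k)})_e$ of $G$. If it has no sink, put $f(e,k+1)=f(e,k)$ for all $e$. Otherwise choose any sink $v_k$ of it (the choice rule is arbitrary and may depend on all the variables $X_{e,k}$), and put $f(e,k+1)=f(e,k)+1$ for the edges $e$ incident to $v_k$ and $f(e,k+1)=f(e,k)$ for all other edges. The number of pops is $\tau=\min\{k\ge 0 : (X_{e,f(e,k)})_e \text{ has no sink}\}\in\{0,1,2,\dots\}\cup\{\infty\}$. For $n\ge 1$, the $n$-cycle has vertices $v_0,\dots,v_{n-1}$ and, for each $i$, an edge joining $v_i$ and $v_{i+1}$ (indices modulo $n$; so the $1$-cycle is a vertex with a self-loop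 and the $2$-cycle has two parallel edges). The $n$-lollipop is a path with $n$ vertices and $n-1$ edges, with a self-loop added at one end. Proposition. For every $n\ge 1$, and for all choice rules on the two graphs, the distribution of $\tau$ for the $n$-cycle is the same as the distribution of $\tau$ for the $n$-lollipop. -/

import Mathlib

open MeasureTheory ProbabilityTheory

namespace SinkPopping

section Graphs

/-- The multigraph (self-loops and parallel edges allowed) on the whole vertex type `α` and the
whole edge type `β` in which the edge `e` has the unordered pair of ends `ends e`. -/
def ofEnds {α β : Type*} (ends : β → Sym2 α) : Graph α β where
  vertexSet := Set.univ
  IsLink e x y := s(x, y) = ends e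
  edgeSet := Set.univ
  isLink_symm _ _ := ⟨fun _ _ h => Sym2.eq_swap.trans h⟩
  eq_or_eq_of_isLink_of_isLink _ _ _ _ _ h h' := by
    rcases Sym2.eq_iff.1 (h.trans h'.symm) with ⟨h, _⟩ | ⟨h, _⟩
    · exact Or.inl h
    · exact Or.inr h
  edge_mem_iff_exists_isLink e := by
    induction h : ends e with
    | _ x y => exact ⟨fun _ => ⟨x, y, rfl⟩, fun _ => Set.mem_univ e⟩
  left_mem_of_isLink _ _ _ _ := Set.mem_univ _

/-- The `n`-cycle: vertices `0, …, n - 1`, and for each `i` an edge joining `i` and `i + 1`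
modulo `n`. The `1`-cycle is a vertex with a self-loop, the `2`-cycle has two parallel edges. -/
def cycle (n : ℕ) [NeZero n] : Graph (Fin n) (Fin n) :=
  ofEnds fun i => s(i, i + 1)

/-- The `n`-lollipop: the path with vertices `0, …, n - 1` and `n - 1` edges, the edge `i` joining
`i` and `i + 1` when `i + 1 < n`, together with a self-loop (the edge `n - 1`) at the end vertex
`n - 1`. -/
def lollipop (n : ℕ) : Graph (Fin n) (Fin n) :=
  ofEnds fun i => if h : i.val + 1 < n then s(i, ⟨i.val + 1, h⟩) else s(i, i)

end Graphs

section Orientations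

variable {α β : Type*} (G : Graph α β)

/-- An orientation of the edge `e`: a choice of tail and head that together are the ends of `e`.
A self-loop has one orientation, every other edge has two. -/
@[ext]
structure EdgeOrientation (e : G.edgeSet) where
  tail : α
  head : α
  isLink : G.IsLink e.1 tail head

/-- An orientation of `G` is an orientation of each of its edges. -/
abbrev Orientation : Type _ := (e : G.edgeSet) → EdgeOrientation G e

variable {G}

/-- A sink is a vertex that is not the tail of any edge. -/
def IsSink (o : Orientation G) (v : α) : Prop :=
  v ∈ G.vertexSet ∧ ∀ e, (o e).tail ≠ v

/-- Sink-free orientations. -/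
def IsSinkFree (o : Orientation G) : Prop := ∀ v, ¬ IsSink o v

end Orientations

section Stacks

variable {α β : Type*} (G : Graph α β)

instance (e : G.edgeSet) : MeasurableSpace (EdgeOrientation G e) := ⊤

instance (e : G.edgeSet) : DiscreteMeasurableSpace (EdgeOrientation G e) := ⟨fun _ => trivial⟩

instance (e : G.edgeSet) : Nonempty (EdgeOrientation G e) := by
  obtain ⟨x, y, h⟩ := G.exists_isLink_of_mem_edgeSet e.2
  exact ⟨⟨x, y, h⟩⟩

instance (e : G.edgeSet) : Finite (EdgeOrientation G e) := by
  obtain ⟨x, y, h⟩ := G.exists_isLink_of_mem_edgeSet e.2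
  refine Set.finite_univ_iff.1 (Set.Finite.subset
    (Set.toFinite {⟨x, y, h⟩, (⟨y, x, h.symm⟩ : EdgeOrientation G e)}) ?_)
  rintro ⟨a, b, hab⟩ -
  rcases hab.eq_and_eq_or_eq_and_eq h with ⟨rfl, rfl⟩ | ⟨rfl, rfl⟩ <;> simp

/-- The sample space: `ω (e, k)` is the orientation of the edge `e` at depth `k` of the stack of
arrows under `e` (depth `0` is the top of the initial stack). It carries the product `σ`-algebra,
generated by the coordinates. -/
abbrev Stacks : Type _ := (p : G.edgeSet × ℕ) → EdgeOrientation G p.1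

/-- The law of the stacks: the coordinates are independent, and each is uniformly distributed on
the orientations of its edge. -/
noncomputable def stackLaw : Measure (Stacks G) :=
  Measure.infinitePi fun p : G.edgeSet × ℕ =>
    uniformOn (Set.univ : Set (EdgeOrientation G p.1))

variable {G}

/-- The orientation of `G` that is visible when the arrow on top of the stack of each edge `e` is
the one of original depth `f e`. -/
def visible (ω : Stacks G) (f : G.edgeSet → ℕ) : Orientation G := fun e => ω (e, f e)

open Classical in
/-- `depth ω v k e` is the original depth of the arrow on top of the stack of the edge `e` at time
`k`, when the vertices `v 0, v 1, …` are popped in this order until the visible orientation is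
sink-free. Popping a vertex removes the top arrow of the stack of each edge incident to it. -/
noncomputable def depth (ω : Stacks G) (v : ℕ → α) : ℕ → G.edgeSet → ℕ
  | 0 => fun _ => 0
  | k + 1 => fun e =>
      if ¬ IsSinkFree (visible ω (depth ω v k)) ∧ G.Inc e.1 (v k) then depth ω v k e + 1
      else depth ω v k e

/-- The orientation of `G` visible at time `k`. -/
noncomputable def stateAt (ω : Stacks G) (v : ℕ → α) (k : ℕ) : Orientation G :=
  visible ω (depth ω v k)

/-- A choice rule: `c ω k` is the sink that is popped at time `k`, chosen arbitrarily among the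
sinks present at that time, as long as there are any (its value is irrelevant afterwards). -/
def IsChoiceRule (c : Stacks G → ℕ → α) : Prop :=
  ∀ ω k, ¬ IsSinkFree (stateAt ω (c ω) k) → IsSink (stateAt ω (c ω) k) (c ω k)

/-- The number of pops before a sink-free orientation is obtained, `⊤` if this never happens. -/
noncomputable def numPops (c : Stacks G → ℕ → α) (ω : Stacks G) : ℕ∞ :=
  sInf ((fun k : ℕ => (k : ℕ∞)) '' {k : ℕ | IsSinkFree (stateAt ω (c ω) k)})

end Stacks

end SinkPopping

/-! Two distinct sinks share no edge, so pops commute and the number of pops depends on the stacks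
alone, not on the choice rule (`Pops.pop`, `numPops_eq_iff`). For a set `I` of vertices, the event
that all of `I` are sinks concerns only arrows that popping `I` removes. It is therefore independent
of the stacks left afterwards, and these are again fresh (`stackLaw_inter_popAll`).

Let `p k` be the probability of exactly `k` pops. For `k ≥ 1` the initial orientation has a sink on
that event, so inclusion–exclusion gives `∑ I, (-1)^|I| * P(I all sinks) * p (k - |I|) = 0`, with
terms `|I| > k` absent. The term `I = ∅` is `p k`, so the law of `τ` is determined recursively by
the law of the number of sinks of a uniform orientation (`popProb_eq`).

It remains to compare sink counts (`sinkMean_cycle`). The lollipop behaves like the cycle with one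
edge frozen, since a loop always has its vertex as tail. Reversing every edge of the cycle exchanges
sinks and sources, which are equinumerous there, so freezing one edge does not change the law of the
sink count. -/

namespace SinkPopping

/-! ### Abelian property of popping. -/

section Dynamics

variable {α β : Type*} {G : Graph α β}

open Classical in
/-- The number of arrows removed from the edge `e` when each vertex of `s` is popped, if no edge
joins two distinct vertices of `s`. -/
noncomputable def popCount (G : Graph α β) (s : Set α) (e : β) : ℕ :=
  if ∃ v ∈ s, G.Inc e v then 1 else 0

/-- The stacks after removing the top arrow from each edge incident to a vertex of `s`. -/
noncomputable def popAll (s : Set α) (ω : Stacks G) : Stacks G := fun p =>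
  ω (p.1, p.2 + popCount G s p.1)

lemma stack_congr (ω : Stacks G) (e : G.edgeSet) {i j : ℕ} (h : i = j) : ω (e, i) = ω (e, j) := by
  subst h
  rfl

/-- The orientation visible on top of the stacks. -/
def top (ω : Stacks G) : Orientation G := visible ω fun _ => 0

/-- `Pops ω k`: some sequence of `k` legal pops leads from `ω` to a sink-free orientation. -/
inductive Pops : Stacks G → ℕ → Prop
  | done {ω : Stacks G} : IsSinkFree (top ω) → Pops ω 0
  | step {ω : Stacks G} {v : α} {k : ℕ} :
      IsSink (top ω) v → Pops (popAll {v} ω) k → Pops ω (k + 1)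

lemma inc_tail_or_tail {e : G.edgeSet} (x : EdgeOrientation G e) {v w : α} (hvw : v ≠ w)
    (hv : G.Inc e.1 v) (hw : G.Inc e.1 w) : x.tail = v ∨ x.tail = w := by
  rcases hv.eq_or_eq_of_isLink x.isLink with h | h
  · exact Or.inl h.symm
  · rcases hw.eq_or_eq_of_isLink x.isLink with h' | h'
    · exact Or.inr h'.symm
    · exact absurd (h.trans h'.symm) hvw

/-- No edge joins two distinct sinks. -/
lemma IsSink.not_inc {o : Orientation G} {v w : α} (hv : IsSink o v) (hw : IsSink o w)
    (hvw : v ≠ w) {e : G.edgeSet} (h : G.Inc e.1 v) : ¬ G.Inc e.1 w := fun h' =>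
  (inc_tail_or_tail (o e) hvw h h').elim (hv.2 e) (hw.2 e)

lemma IsSink.congr {o o' : Orientation G} {v : α} (hv : IsSink o v)
    (h : ∀ e : G.edgeSet, G.Inc e.1 v → o' e = o e) : IsSink o' v := by
  refine ⟨hv.1, fun e he => ?_⟩
  have hi : G.Inc e.1 v := he ▸ (o' e).isLink.inc_left
  exact hv.2 e (h e hi ▸ he)

/-- Popping other sinks touches no edge at `v`. -/
lemma isSink_top_popAll {ω : Stacks G} {s : Set α} (hs : ∀ w ∈ s, IsSink (top ω) w) {v : α}
    (hv : IsSink (top ω) v) (hvs : v ∉ s) : IsSink (top (popAll s ω)) v := by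
  refine hv.congr fun e he => ?_
  have : ¬ ∃ w ∈ s, G.Inc e.1 w := by
    rintro ⟨w, hw, h⟩
    exact hv.not_inc (hs w hw) (fun h' => hvs (h' ▸ hw)) he h
  exact stack_congr ω e (by simp [popCount, this])

lemma popAll_empty (ω : Stacks G) : popAll ∅ ω = ω := by
  funext p
  exact stack_congr ω p.1 (by simp [popCount])

lemma popAll_popAll {ω : Stacks G} {s t : Set α} (hs : ∀ w ∈ s, IsSink (top ω) w)
    (ht : ∀ w ∈ t, IsSink (top ω) w) (hst : Disjoint s t) :
    popAll s (popAll t ω) = popAll (s ∪ t) ω := by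
  classical
  funext p
  have key : ¬ ((∃ v ∈ s, G.Inc p.1.1 v) ∧ ∃ v ∈ t, G.Inc p.1.1 v) := by
    rintro ⟨⟨v, hv, h⟩, w, hw, h'⟩
    exact (hs v hv).not_inc (ht w hw) (hst.ne_of_mem hv hw) h h'
  have hu : (∃ v ∈ s ∪ t, G.Inc p.1.1 v) ↔
      (∃ v ∈ s, G.Inc p.1.1 v) ∨ ∃ v ∈ t, G.Inc p.1.1 v := by
    simp only [Set.mem_union, or_and_right, exists_or]
  refine stack_congr ω p.1 ?_
  unfold popCount
  simp only [hu, add_assoc]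
  by_cases h1 : ∃ v ∈ s, G.Inc p.1.1 v <;> by_cases h2 : ∃ v ∈ t, G.Inc p.1.1 v
  · exact absurd ⟨h1, h2⟩ key
  all_goals simp only [h1, h2, if_true, if_false, or_true, or_false, add_zero, zero_add]

lemma Pops.eq_zero {ω : Stacks G} {k : ℕ} (h : Pops ω k) (hω : IsSinkFree (top ω)) : k = 0 := by
  cases h with
  | done => rfl
  | step hv _ => exact absurd hv (hω _)

lemma pops_zero_iff {ω : Stacks G} : Pops ω 0 ↔ IsSinkFree (top ω) :=
  ⟨fun h => by cases h; assumption, Pops.done⟩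

/-- The abelian property: every sink may be popped first. -/
lemma Pops.pop {ω : Stacks G} {k : ℕ} (h : Pops ω k) :
    ∀ {v : α}, IsSink (top ω) v → ∃ j, k = j + 1 ∧ Pops (popAll {v} ω) j := by
  induction h with
  | done h => exact fun hv => absurd hv (h _)
  | @step ω w k hw h ih =>
    intro v hv
    refine ⟨k, rfl, ?_⟩
    by_cases hvw : v = w
    · exact hvw ▸ h
    · have h1 : ∀ x ∈ ({v} : Set α), IsSink (top ω) x := by rintro x rfl; exact hv
      have h2 : ∀ x ∈ ({w} : Set α), IsSink (top ω) x := by rintro x rfl; exact hw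
      -- Diamond argument: `v` survives the pop of `w`, so by induction it may come second; the pops
      -- of `w` and `v` are then exchanged.
      obtain ⟨j, rfl, hj⟩ := ih (isSink_top_popAll h2 hv (by simpa using hvw))
      refine .step (isSink_top_popAll h1 hw (by simpa using Ne.symm hvw)) ?_
      have hd : Disjoint ({v} : Set α) {w} := by simpa using hvw
      rwa [popAll_popAll h2 h1 hd.symm, Set.union_comm, ← popAll_popAll h1 h2 hd]

lemma pops_succ_iff {ω : Stacks G} {v : α} (hv : IsSink (top ω) v) {k : ℕ} :
    Pops ω (k + 1) ↔ Pops (popAll {v} ω) k := by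
  refine ⟨fun h => ?_, Pops.step hv⟩
  obtain ⟨j, hj, h⟩ := h.pop hv
  exact Nat.succ.inj hj ▸ h

/-- All vertices of a set of sinks may be popped first. -/
lemma pops_iff_popAll (I : Finset α) : ∀ {ω : Stacks G}, (∀ v ∈ I, IsSink (top ω) v) → ∀ k,
    Pops ω k ↔ I.card ≤ k ∧ Pops (popAll I ω) (k - I.card) := by
  classical
  induction I using Finset.induction_on with
  | empty => simp [popAll_empty]
  | insert v I hv ih =>
    intro ω h k
    have hvs : IsSink (top ω) v := h v (Finset.mem_insert_self _ _)
    have h1 : ∀ x ∈ ({v} : Set α), IsSink (top ω) x := by rintro x rfl; exact hvs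
    have hI : ∀ x ∈ I, IsSink (top ω) x := fun x hx => h x (Finset.mem_insert_of_mem hx)
    have hpop : popAll (insert v I : Finset α) ω = popAll I (popAll {v} ω) := by
      rw [popAll_popAll hI h1 (by simpa using hv)]
      simp
    rw [Finset.card_insert_of_notMem hv, hpop]
    cases k with
    | zero =>
      simp only [Nat.le_zero, Nat.add_eq_zero_iff, one_ne_zero, and_false, false_and, iff_false]
      exact fun h0 => pops_zero_iff.1 h0 v hvs
    | succ k =>
      rw [pops_succ_iff hvs, ih fun x hx => isSink_top_popAll h1 (hI x hx) ?_]
      · simp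
      · rintro rfl
        exact hv hx

/-- By the abelian property, the second sequence can be taken to start with the same sink as the
first. -/
lemma Pops.unique {ω : Stacks G} {k : ℕ} (h : Pops ω k) : ∀ {j}, Pops ω j → k = j := by
  induction h with
  | done h => exact fun hj => (hj.eq_zero h).symm
  | step hv _ ih =>
    intro j hj
    obtain ⟨i, rfl, hi⟩ := hj.pop hv
    rw [ih hi]

/-- The stacks left when `f e` arrows have been removed from each edge `e`. -/
def dropArrows (ω : Stacks G) (f : G.edgeSet → ℕ) : Stacks G := fun p => ω (p.1, f p.1 + p.2)

lemma top_dropArrows (ω : Stacks G) (f : G.edgeSet → ℕ) : top (dropArrows ω f) = visible ω f := rfl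

lemma dropArrows_depth_zero (ω : Stacks G) (v : ℕ → α) : dropArrows ω (depth ω v 0) = ω := by
  funext p
  exact stack_congr ω p.1 (zero_add _)

lemma dropArrows_depth_succ {ω : Stacks G} {v : ℕ → α} {k : ℕ}
    (h : ¬ IsSinkFree (stateAt ω v k)) :
    dropArrows ω (depth ω v (k + 1)) = popAll {v k} (dropArrows ω (depth ω v k)) := by
  funext p
  have h' : ¬ IsSinkFree (visible ω (depth ω v k)) := h
  refine stack_congr ω p.1 ?_
  by_cases hp : G.Inc p.1.1 (v k)
  · simp [depth, popCount, h', hp, add_assoc, add_comm 1]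
  · simp [depth, popCount, h', hp]

lemma pops_dropArrows_iff {c : Stacks G → ℕ → α} (hc : IsChoiceRule c) (ω : Stacks G) {j : ℕ}
    (hj : ∀ i < j, ¬ IsSinkFree (stateAt ω (c ω) i)) (k : ℕ) :
    Pops ω (k + j) ↔ Pops (dropArrows ω (depth ω (c ω) j)) k := by
  induction j generalizing k with
  | zero => rw [dropArrows_depth_zero, add_zero]
  | succ j ih =>
    have hs := hj j j.lt_succ_self
    rw [dropArrows_depth_succ hs, ← pops_succ_iff (by rw [top_dropArrows]; exact hc ω j hs),
      ← ih (fun i hi => hj i (hi.trans j.lt_succ_self)), add_right_comm, add_assoc]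

lemma numPops_eq_iff {c : Stacks G → ℕ → α} (hc : IsChoiceRule c) (ω : Stacks G) (k : ℕ) :
    numPops c ω = k ↔ Pops ω k := by
  classical
  by_cases hex : ∃ k, IsSinkFree (stateAt ω (c ω) k)
  · have h1 : numPops c ω = (Nat.find hex : ℕ) := by
      refine le_antisymm (sInf_le ⟨_, Nat.find_spec hex, rfl⟩) (le_sInf ?_)
      rintro _ ⟨m, hm, rfl⟩
      exact Nat.cast_le.2 (Nat.find_min' hex hm)
    have h2 : Pops ω (Nat.find hex) := by
      have := (pops_dropArrows_iff hc ω (fun i hi => Nat.find_min hex hi) 0).2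
        (.done (Nat.find_spec hex))
      simpa using this
    rw [h1, Nat.cast_inj]
    exact ⟨fun h => h ▸ h2, fun h => h2.unique h⟩
  · push Not at hex
    have h1 : numPops c ω = ⊤ := by simp [numPops, hex]
    -- If `Pops ω k` held, the first `k` pops of the rule would already leave a sink-free
    -- orientation.
    refine iff_of_false (by simp [h1]) fun h => hex k ?_
    have := (pops_dropArrows_iff hc ω (j := k) (fun i _ => hex i) 0).1 (by simpa using h)
    exact pops_zero_iff.1 this

end Dynamics

/-! ### Independence and freshness of the stacks. -/

section Law

variable {α β : Type*} (G : Graph α β)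

instance (e : G.edgeSet) :
    IsProbabilityMeasure (uniformOn (Set.univ : Set (EdgeOrientation G e))) :=
  isProbabilityMeasure_uniformOn Set.finite_univ Set.univ_nonempty

instance : IsProbabilityMeasure (stackLaw G) :=
  inferInstanceAs (IsProbabilityMeasure (Measure.infinitePi _))

noncomputable instance [Finite β] : Fintype (Orientation G) := Fintype.ofFinite _

variable {G}

lemma measurable_top : Measurable (top : Stacks G → Orientation G) :=
  measurable_pi_lambda _ fun e => measurable_pi_apply (e, 0)

lemma measurable_popAll (s : Set α) : Measurable (popAll s : Stacks G → Stacks G) :=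
  measurable_pi_lambda _ fun p => measurable_pi_apply (p.1, p.2 + popCount G s p.1)

lemma measurableSet_top_mem [Finite β] (s : Set (Orientation G)) :
    MeasurableSet {ω : Stacks G | top ω ∈ s} :=
  measurable_top s.toFinite.measurableSet

lemma measurableSet_pops [Finite α] [Finite β] (k : ℕ) :
    MeasurableSet {ω : Stacks G | Pops ω k} := by
  induction k with
  | zero =>
    simp only [pops_zero_iff]
    exact measurableSet_top_mem {o | IsSinkFree o}
  | succ k ih =>
    have : {ω : Stacks G | Pops ω (k + 1)} =
        ⋃ v : α, {ω | top ω ∈ {o | IsSink o v}} ∩ popAll {v} ⁻¹' {ω | Pops ω k} := by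
      ext ω
      simp only [Set.mem_ofPred_eq, Set.mem_iUnion, Set.mem_inter_iff, Set.mem_preimage]
      constructor
      · rintro (_ | ⟨hv, h⟩)
        exact ⟨_, hv, h⟩
      · rintro ⟨v, hv, h⟩
        exact .step hv h
    rw [this]
    exact .iUnion fun v => (measurableSet_top_mem _).inter (measurable_popAll _ ih)

lemma iIndepFun_stacks :
    iIndepFun (fun (p : G.edgeSet × ℕ) (ω : Stacks G) => ω p) (stackLaw G) :=
  iIndepFun_infinitePi (X := fun _ x => x) fun _ => measurable_id

lemma stackLaw_map_eval (p : G.edgeSet × ℕ) :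
    (stackLaw G).map (fun ω => ω p) = uniformOn (Set.univ : Set (EdgeOrientation G p.1)) :=
  Measure.infinitePi_map_eval _ p

lemma popAll_index_injective (s : Set α) : Function.Injective
    fun p : G.edgeSet × ℕ => (p.1, p.2 + popCount G s p.1) := by
  rintro ⟨e, i⟩ ⟨e', j⟩ h
  obtain ⟨rfl, h⟩ := Prod.ext_iff.1 h
  simpa using h

/-- The stacks left after popping a fixed set of vertices have the law of fresh stacks. -/
lemma stackLaw_map_popAll (s : Set α) : (stackLaw G).map (popAll s) = stackLaw G := by
  have h := (iIndepFun_stacks (G := G)).precomp (popAll_index_injective s)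
  have h' := iIndepFun.map_fun_eq_infinitePi_map (fun p => measurable_pi_apply _) h
  simp only [stackLaw_map_eval] at h'
  exact h'

/-- In the visible orientation, the orientations of the edges are independent and uniform. -/
lemma stackLaw_map_top :
    (stackLaw G).map top = Measure.infinitePi fun e : G.edgeSet =>
      uniformOn (Set.univ : Set (EdgeOrientation G e)) := by
  have hinj : Function.Injective fun e : G.edgeSet => (e, 0) := fun e e' h => (Prod.ext_iff.1 h).1
  have h := (iIndepFun_stacks (G := G)).precomp hinj
  refine (iIndepFun.map_fun_eq_infinitePi_map (fun p => measurable_pi_apply _) h).trans ?_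
  exact congrArg _ (funext fun e => stackLaw_map_eval (e, 0))

/-- The visible orientation is uniformly distributed. -/
lemma stackLaw_map_top_real_singleton [Finite β] (o : Orientation G) :
    ((stackLaw G).map top).real {o} = (Fintype.card (Orientation G) : ℝ)⁻¹ := by
  classical
  have := Fintype.ofFinite G.edgeSet
  have := fun e : G.edgeSet => Fintype.ofFinite (EdgeOrientation G e)
  have hc : Fintype.card (Orientation G) =
      ∏ e : G.edgeSet, Fintype.card (EdgeOrientation G e) := by
    simp only [← Nat.card_eq_fintype_card]
    exact Nat.card_pi
  rw [stackLaw_map_top, Measure.real, Measure.infinitePi_singleton_of_fintype, hc,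
    ENNReal.toReal_prod, Nat.cast_prod, ← Finset.prod_inv_distrib]
  refine Finset.prod_congr rfl fun e _ => ?_
  rw [uniformOn_univ, Measure.count_singleton]
  simp

/-- The event that all vertices of `s` are sinks is independent of the stacks left after popping
these vertices. -/
lemma stackLaw_inter_popAll [Finite α] [Finite β] (s : Set α) {A : Set (Stacks G)}
    (hA : MeasurableSet A) :
    stackLaw G ({ω | ∀ v ∈ s, IsSink (top ω) v} ∩ popAll s ⁻¹' A) =
      stackLaw G {ω | ∀ v ∈ s, IsSink (top ω) v} * stackLaw G A := by
  let m : G.edgeSet × ℕ → MeasurableSpace (Stacks G) := fun p =>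
    MeasurableSpace.comap (fun ω => ω p) inferInstance
  -- `T` indexes the arrows that remain after popping `s`; its complement consists of the top arrows
  -- of the edges meeting `s`, which alone decide whether `s` consists of sinks.
  let T : Set (G.edgeSet × ℕ) := Set.range fun p : G.edgeSet × ℕ => (p.1, p.2 + popCount G s p.1)
  have hind : Indep (⨆ p ∈ Tᶜ, m p) (⨆ p ∈ T, m p) (stackLaw G) :=
    indep_iSup_of_disjoint (fun p => (measurable_pi_apply p).comap_le)
      iIndepFun_stacks disjoint_compl_left
  have h1 : MeasurableSet[⨆ p ∈ Tᶜ, m p] {ω | ∀ v ∈ s, IsSink (top ω) v} := by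
    have : {ω : Stacks G | ∀ v ∈ s, IsSink (top ω) v} =
        ⋂ v ∈ s, ({_ω | v ∈ G.vertexSet} ∩ ⋂ e : G.edgeSet, {ω | (ω (e, 0)).tail ≠ v}) := by
      ext ω
      simp [IsSink, top, visible]
    rw [this]
    refine .iInter fun v => .iInter fun hv => .inter (.const _) (.iInter fun e => ?_)
    by_cases he : G.Inc e.1 v
    · have hmem : (e, 0) ∈ Tᶜ := by
        rintro ⟨⟨e', i⟩, h⟩
        obtain ⟨rfl, h⟩ := Prod.ext_iff.1 h
        have : popCount G s e' = 1 := if_pos ⟨v, hv, he⟩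
        simp [this] at h
      exact le_iSup₂ (f := fun p (_ : p ∈ Tᶜ) => m p) (e, 0) hmem _
        ⟨{x | x.tail ≠ v}, trivial, rfl⟩
    · have : {ω : Stacks G | (ω (e, 0)).tail ≠ v} = Set.univ :=
        Set.eq_univ_of_forall fun ω h => he (h ▸ (ω (e, 0)).isLink.inc_left)
      rw [this]
      exact .univ
  have h2 : MeasurableSet[⨆ p ∈ T, m p] (popAll s ⁻¹' A) := by
    have hm : Measurable[⨆ p ∈ T, m p] (popAll s : Stacks G → Stacks G) := by
      refine @measurable_pi_lambda _ _ _ (_) _ _ fun p => ?_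
      refine Measurable.mono (comap_measurable _)
        (le_iSup₂ (f := fun p (_ : p ∈ T) => m p) (p.1, p.2 + popCount G s p.1) ⟨p, rfl⟩) le_rfl
    exact hm hA
  rw [(Indep_iff _ _ _).1 hind _ _ h1 h2, ← Measure.map_apply (measurable_popAll s) hA,
    stackLaw_map_popAll]

/-- The choice rule itself need not be measurable, because the events `Pops ω k` do not involve it.
-/
lemma measurable_numPops [Finite α] [Finite β] {c : Stacks G → ℕ → α} (hc : IsChoiceRule c) :
    Measurable (numPops c) := by
  refine ENat.measurable_iff.2 fun k => ?_
  have : numPops c ⁻¹' {(k : ℕ∞)} = {ω | Pops ω k} := by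
    ext ω
    exact numPops_eq_iff hc ω k
  exact this ▸ measurableSet_pops k

end Law

/-! ### Inclusion–exclusion over sets of sinks. -/

section Counting

variable {α β : Type*} [Fintype α] {G : Graph α β}

open Classical in
/-- The set of sinks of an orientation. -/
noncomputable def sinks (o : Orientation G) : Finset α := Finset.univ.filter (IsSink o)

lemma mem_sinks {o : Orientation G} {v : α} : v ∈ sinks o ↔ IsSink o v := by simp [sinks]

lemma isSinkFree_iff {o : Orientation G} : IsSinkFree o ↔ sinks o = ∅ := by
  simp [IsSinkFree, Finset.eq_empty_iff_forall_notMem, mem_sinks]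

/-- The binomial transform of a sequence. -/
def binomialSum (g : ℕ → ℝ) (n : ℕ) : ℝ := ∑ j ∈ Finset.range (n + 1), n.choose j • g j

variable [Finite β]

/-- Double counting: an orientation with `m` sinks is counted once for each of the `m.choose j` sets
of `j` sinks. -/
lemma sum_mul_measureReal_sinks (ν : Measure (Orientation G)) [IsFiniteMeasure ν] (g : ℕ → ℝ) :
    ∑ I : Finset α, g I.card * ν.real {o | ∀ v ∈ I, IsSink o v} =
      ∑ o, ν.real {o} * binomialSum g (sinks o).card := by
  classical
  have h (I : Finset α) : ν.real {o | ∀ v ∈ I, IsSink o v} =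
      ∑ o, if I ⊆ sinks o then ν.real {o} else 0 := by
    rw [← Finset.sum_filter, sum_measureReal_singleton]
    congr 1
    ext o
    simp [Finset.subset_iff, mem_sinks]
  simp only [h, Finset.mul_sum]
  rw [Finset.sum_comm]
  refine Finset.sum_congr rfl fun o _ => ?_
  rw [binomialSum, ← Finset.sum_powerset_apply_card, Finset.mul_sum]
  simp only [mul_ite, mul_zero]
  rw [← Finset.sum_filter]
  refine Finset.sum_congr ?_ fun I _ => mul_comm _ _
  ext I
  simp

lemma binomialSum_neg_one_pow (n : ℕ) : binomialSum (fun j => (-1) ^ j) n =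
    if n = 0 then 1 else 0 := by
  have := Int.alternating_sum_range_choose (n := n)
  have h : ((∑ m ∈ Finset.range (n + 1), ((-1) ^ m * (n.choose m) : ℤ) : ℤ) : ℝ) =
    ((if n = 0 then 1 else 0 : ℤ) : ℝ) := by rw [this]
  push_cast at h
  rw [← h]
  exact Finset.sum_congr rfl fun j _ => by rw [nsmul_eq_mul, mul_comm]

/-- Inclusion–exclusion over the sets of sinks. -/
lemma measureReal_isSinkFree (ν : Measure (Orientation G)) [IsFiniteMeasure ν] :
    ν.real {o | IsSinkFree o} =
      ∑ I : Finset α, (-1) ^ I.card * ν.real {o | ∀ v ∈ I, IsSink o v} := by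
  classical
  rw [sum_mul_measureReal_sinks ν fun j => (-1) ^ j]
  simp only [binomialSum_neg_one_pow, mul_ite, mul_one, mul_zero, Finset.card_eq_zero]
  rw [← Finset.sum_filter, sum_measureReal_singleton]
  congr 1
  ext o
  simp [isSinkFree_iff]

variable (G) in
/-- The mean of `f` over the number of sinks of a uniformly random orientation. -/
noncomputable def sinkMean (f : ℕ → ℝ) : ℝ :=
  (∑ o : Orientation G, f (sinks o).card) / Fintype.card (Orientation G)

lemma sinkMean_add (f g : ℕ → ℝ) : sinkMean G (f + g) = sinkMean G f + sinkMean G g := by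
  simp [sinkMean, Finset.sum_add_distrib, add_div]

lemma sinkMean_const (a : ℝ) : sinkMean G (fun _ => a) = a := by
  have : (Fintype.card (Orientation G) : ℝ) ≠ 0 := by simp [Fintype.card_ne_zero]
  simp [sinkMean, this]

lemma sum_mul_stackLaw_sinks (g : ℕ → ℝ) :
    ∑ I : Finset α, g I.card * (stackLaw G).real {ω | ∀ v ∈ I, IsSink (top ω) v} =
      sinkMean G (binomialSum g) := by
  have := Measure.isProbabilityMeasure_map (μ := stackLaw G) (measurable_top (G := G)).aemeasurable
  have h := sum_mul_measureReal_sinks ((stackLaw G).map top) g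
  simp only [stackLaw_map_top_real_singleton, ← Finset.mul_sum] at h
  rw [sinkMean, div_eq_inv_mul, ← h]
  refine Finset.sum_congr rfl fun I _ => ?_
  rw [map_measureReal_apply measurable_top (Set.toFinite _).measurableSet]
  rfl

variable (G) in
/-- The probability that exactly `k` pops occur. -/
noncomputable def popProb (k : ℕ) : ℝ := (stackLaw G).real {ω | Pops ω k}

lemma popProb_zero : popProb G 0 = sinkMean G (binomialSum fun j => (-1) ^ j) := by
  have := Measure.isProbabilityMeasure_map (μ := stackLaw G) (measurable_top (G := G)).aemeasurable
  have h := measureReal_isSinkFree ((stackLaw G).map top)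
  rw [map_measureReal_apply measurable_top (Set.toFinite _).measurableSet] at h
  simp only [popProb, pops_zero_iff]
  refine h.trans ?_
  rw [← sum_mul_stackLaw_sinks]
  refine Finset.sum_congr rfl fun I _ => ?_
  rw [map_measureReal_apply measurable_top (Set.toFinite _).measurableSet]
  rfl

/-- Popping `I` first uses `I.card` pops and leaves fresh stacks, independent of the event that `I`
consists of sinks. -/
lemma stackLaw_sinks_inter_pops (I : Finset α) (k : ℕ) :
    (stackLaw G).real ({ω | ∀ v ∈ I, IsSink (top ω) v} ∩ {ω | Pops ω k}) =
      (if I.card ≤ k then popProb G (k - I.card) else 0) *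
        (stackLaw G).real {ω | ∀ v ∈ I, IsSink (top ω) v} := by
  split_ifs with h
  · have heq : {ω : Stacks G | ∀ v ∈ I, IsSink (top ω) v} ∩ {ω | Pops ω k} =
        {ω | ∀ v ∈ (I : Set α), IsSink (top ω) v} ∩
          popAll I ⁻¹' {ω | Pops ω (k - I.card)} := by
      ext ω
      refine and_congr_right fun hω => ?_
      exact (pops_iff_popAll I hω k).trans (and_iff_right h)
    rw [heq, Measure.real, stackLaw_inter_popAll _ (measurableSet_pops _), ENNReal.toReal_mul,
      mul_comm]
    rfl
  · have heq : {ω : Stacks G | ∀ v ∈ I, IsSink (top ω) v} ∩ {ω | Pops ω k} = ∅ :=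
      Set.eq_empty_of_forall_notMem fun ω hω => h ((pops_iff_popAll I hω.1 k).1 hω.2).1
    simp [heq]

/-- The recursion that determines the law of the number of pops. -/
lemma sinkMean_popProb {k : ℕ} (hk : k ≠ 0) :
    sinkMean G (binomialSum fun j => (-1) ^ j * if j ≤ k then popProb G (k - j) else 0) = 0 := by
  have hA := measurableSet_pops (G := G) k
  -- Restricting to `k` pops makes the sink-free side of inclusion–exclusion vanish, as `k ≠ 0`.
  have h := measureReal_isSinkFree (((stackLaw G).restrict {ω | Pops ω k}).map top)
  have hm (s : Set (Orientation G)) :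
      (((stackLaw G).restrict {ω | Pops ω k}).map top).real s =
        (stackLaw G).real ({ω | top ω ∈ s} ∩ {ω | Pops ω k}) := by
    rw [map_measureReal_apply measurable_top (Set.toFinite _).measurableSet,
      measureReal_restrict_apply (measurable_top (Set.toFinite _).measurableSet)]
    rfl
  simp only [hm, Set.mem_ofPred_eq, stackLaw_sinks_inter_pops] at h
  rw [← sum_mul_stackLaw_sinks]
  simp only [mul_assoc]
  rw [← h]
  have heq : {ω : Stacks G | IsSinkFree (top ω)} ∩ {ω | Pops ω k} = ∅ :=
    Set.eq_empty_of_forall_notMem fun ω hω => hk (hω.2.eq_zero hω.1)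
  simp [heq]

/-- Isolates the contribution of `I = ∅`, which in the recursion is the unknown `popProb G k`. -/
lemma binomialSum_eq_add (g : ℕ → ℝ) :
    binomialSum g = binomialSum (fun j => if j = 0 then 0 else g j) + fun _ => g 0 := by
  funext n
  simp [binomialSum, Finset.sum_range_succ']

end Counting

/-! ### The sink count determines the law of the number of pops. -/

section Comparison

variable {α β : Type*} [Fintype α] [Finite β] {G : Graph α β}
variable {α' β' : Type*} [Fintype α'] [Finite β'] {H : Graph α' β'}

lemma popProb_eq (h : sinkMean G = sinkMean H) (k : ℕ) : popProb G k = popProb H k := by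
  induction k using Nat.strong_induction_on with
  | _ k ih =>
  rcases eq_or_ne k 0 with rfl | hk
  · rw [popProb_zero, popProb_zero, h]
  · have h1 := sinkMean_popProb (G := G) hk
    have h2 := sinkMean_popProb (G := H) hk
    rw [binomialSum_eq_add, sinkMean_add, sinkMean_const] at h1 h2
    have hg : (fun j => if j = 0 then 0 else (-1) ^ j * if j ≤ k then popProb G (k - j) else 0) =
        fun j => if j = 0 then 0 else (-1) ^ j * if j ≤ k then popProb H (k - j) else 0 := by
      funext j
      split_ifs with hj hjk
      · rfl
      · rw [ih _ (by omega)]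
      · rfl
    rw [hg, h] at h1
    simpa using h1.trans h2.symm

/-- A probability measure on `ℕ∞` is determined by the masses of the natural numbers. -/
lemma measure_ext_enat {μ ν : Measure ℕ∞} [IsProbabilityMeasure μ] [IsProbabilityMeasure ν]
    (h : ∀ k : ℕ, μ {(k : ℕ∞)} = ν {(k : ℕ∞)}) : μ = ν := by
  have htop : ({⊤} : Set ℕ∞) = (⋃ k : ℕ, {(k : ℕ∞)})ᶜ := by
    ext x
    induction x <;> simp
  have hd : Pairwise (Function.onFun Disjoint fun k : ℕ => ({(k : ℕ∞)} : Set ℕ∞)) := by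
    intro i j hij
    simpa [Function.onFun] using hij
  refine Measure.ext_of_singleton fun x => ?_
  induction x with
  | coe k => exact h k
  | top =>
    rw [htop, prob_compl_eq_one_sub .of_discrete, prob_compl_eq_one_sub .of_discrete,
      measure_iUnion hd fun _ => .of_discrete, measure_iUnion hd fun _ => .of_discrete]
    simp only [h]

/-- The law of the number of pops depends only on the law of the number of sinks of a uniformly
random orientation. -/
theorem identDistrib_numPops (h : sinkMean G = sinkMean H)
    {c : Stacks G → ℕ → α} (hc : IsChoiceRule c) {d : Stacks H → ℕ → α'} (hd : IsChoiceRule d) :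
    IdentDistrib (numPops c) (numPops d) (stackLaw G) (stackLaw H) := by
  have hmc := measurable_numPops hc
  have hmd := measurable_numPops hd
  have := Measure.isProbabilityMeasure_map (μ := stackLaw G) hmc.aemeasurable
  have := Measure.isProbabilityMeasure_map (μ := stackLaw H) hmd.aemeasurable
  refine ⟨hmc.aemeasurable, hmd.aemeasurable, measure_ext_enat fun k => ?_⟩
  rw [Measure.map_apply hmc trivial, Measure.map_apply hmd trivial]
  have hG : numPops c ⁻¹' {(k : ℕ∞)} = {ω | Pops ω k} := Set.ext fun ω => numPops_eq_iff hc ω k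
  have hH : numPops d ⁻¹' {(k : ℕ∞)} = {ω | Pops ω k} := Set.ext fun ω => numPops_eq_iff hd ω k
  rw [hG, hH]
  exact (measureReal_eq_measureReal_iff).1 (popProb_eq h k)

end Comparison

/-! ### Sinks of cycle orientations as patterns in binary words. -/

section CyclicWords

variable {n : ℕ} [NeZero n]

/-- The tails of the edges of the `n`-cycle when the edge `i` points from `i` to `i + 1` if `b i`
holds, and from `i + 1` to `i` otherwise. -/
def tailOf (b : Fin n → Bool) (i : Fin n) : Fin n := if b i then i else i + 1

/-- The number of vertices that are not the tail of an edge. -/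
def sinkCount (b : Fin n → Bool) : ℕ := (Finset.univ.filter fun v => ∀ i, tailOf b i ≠ v).card

lemma forall_tailOf_ne_iff (b : Fin n → Bool) (v : Fin n) :
    (∀ i, tailOf b i ≠ v) ↔ b v = false ∧ b (v - 1) = true := by
  constructor
  · intro h
    constructor
    · by_contra hb
      exact h v (if_pos (by simpa using hb))
    · by_contra hb
      exact h (v - 1) ((if_neg hb).trans (sub_add_cancel _ _))
  · rintro ⟨h1, h2⟩ i hi
    unfold tailOf at hi
    split_ifs at hi with hb
    · subst hi
      simp [hb] at h1
    · subst hi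
      rw [add_sub_cancel_right] at h2
      exact hb h2

/-- Reversing all edges of the cycle does not change the number of sinks: it turns sinks into
sources. -/
lemma sinkCount_not (b : Fin n → Bool) : sinkCount (fun i => !b i) = sinkCount b := by
  have h : (Finset.univ.filter fun v : Fin n => b (v - 1) = false).card =
      (Finset.univ.filter fun v => b v = false).card :=
    Finset.card_bij (fun v _ => v - 1) (by simp) (by simp)
      fun v hv => ⟨v + 1, by simpa using hv, by simp⟩
  -- Sets of equal size have differences of equal size; here the two differences are the sinks of
  -- `b` and of its reversal.
  have h' := Finset.card_sdiff_comm h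
  simp only [sinkCount, forall_tailOf_ne_iff]
  convert h' using 2 <;> ext v <;> simp [and_comm]

/-- The number of sinks has the same law when the orientation of one edge of the cycle is fixed. -/
lemma sum_sinkCount (f : ℕ → ℝ) (l : Fin n) :
    ∑ b : Fin n → Bool, f (sinkCount b) =
      2 * ∑ b : Fin n → Bool with b l = true, f (sinkCount b) := by
  rw [← Finset.sum_filter_add_sum_filter_not _ fun b : Fin n → Bool => b l = true, two_mul]
  congr 1
  refine Finset.sum_nbij' (fun b i => !b i) (fun b i => !b i) ?_ ?_ ?_ ?_ ?_
  all_goals simp [sinkCount_not]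

end CyclicWords

/-! ### Comparing the cycle with the lollipop. -/

section Graphs

variable {n : ℕ} [NeZero n]

lemma EdgeOrientation.ext_tail {α β : Type*} {G : Graph α β} {e : G.edgeSet}
    {x y : EdgeOrientation G e} (h : x.tail = y.tail) : x = y :=
  EdgeOrientation.ext h (x.isLink.right_unique (h ▸ y.isLink))

lemma add_one_ne_self (hn : n ≠ 1) (i : Fin n) : i + 1 ≠ i := by
  intro h
  have : (1 : Fin n) = 0 := by simpa using h
  exact hn (Fin.one_eq_zero_iff.1 this)

/-- Orientations of a graph on `Fin n` encoded by binary words. -/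
lemma sum_sinks (hn : n ≠ 1) {G : Graph (Fin n) (Fin n)} (hV : G.vertexSet = Set.univ)
    (hE : G.edgeSet = Set.univ) (hG : ∀ e x, G.Inc e x → x = e ∨ x = e + 1)
    (S : Finset (Fin n → Bool)) (hS : ∀ b, b ∈ S ↔ ∀ e, G.Inc e (tailOf b e)) (f : ℕ → ℝ) :
    ∑ o : Orientation G, f (sinks o).card = ∑ b ∈ S, f (sinkCount b) := by
  have hE' (e : Fin n) : e ∈ G.edgeSet := hE ▸ Set.mem_univ e
  let j (o : Orientation G) (e : Fin n) : Bool := decide ((o ⟨e, hE' e⟩).tail = e)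
  have htail (o : Orientation G) (e : Fin n) : tailOf (j o) e = (o ⟨e, hE' e⟩).tail := by
    by_cases h : (o ⟨e, hE' e⟩).tail = e
    · simp [tailOf, j, h]
    · have := (hG e _ (o ⟨e, hE' e⟩).isLink.inc_left).resolve_left h
      simp [tailOf, j, this, add_one_ne_self hn]
  refine Finset.sum_bij (fun o _ => j o) ?_ ?_ ?_ ?_
  · intro o _
    exact (hS _).2 fun e => by
      rw [htail]
      exact (o ⟨e, hE' e⟩).isLink.inc_left
  · intro o _ o' _ h
    funext e
    refine EdgeOrientation.ext_tail ?_
    rw [← htail o e.1, ← htail o' e.1, h]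
  · intro b hb
    choose y hy using (hS b).1 hb
    refine ⟨fun e => ⟨tailOf b e, y e, hy e⟩, Finset.mem_univ _, ?_⟩
    funext e
    by_cases h : b e = true
    · simp [j, tailOf, h]
    · simp [j, tailOf, h, add_one_ne_self hn]
  · intro o _
    rw [sinkCount]
    congr 2
    ext v
    simp only [mem_sinks, IsSink, hV, Set.mem_univ, true_and, Finset.mem_filter, Finset.mem_univ,
      htail]
    exact ⟨fun h e => h ⟨e, hE' e⟩, fun h e => h e.1⟩

lemma cycle_inc {e x : Fin n} : (cycle n).Inc e x ↔ x = e ∨ x = e + 1 := by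
  simp only [Graph.Inc, cycle, ofEnds, Sym2.eq_iff]
  grind

lemma lollipop_inc {e x : Fin n} :
    (lollipop n).Inc e x ↔ x = e ∨ e.val + 1 < n ∧ x = e + 1 := by
  simp only [Graph.Inc, lollipop, ofEnds]
  split_ifs with h
  · have : (⟨e.val + 1, h⟩ : Fin n) = e + 1 := by
      ext
      rw [Fin.val_add, Fin.val_one', Nat.add_mod_mod, Nat.mod_eq_of_lt h]
    simp only [Sym2.eq_iff, this]
    grind
  · simp only [Sym2.eq_iff]
    grind

/-- A uniformly random orientation of the `n`-cycle has the same number of sinks in law as a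
uniformly random orientation of the `n`-lollipop. -/
theorem sinkMean_cycle : sinkMean (cycle n) = sinkMean (lollipop n) := by
  funext f
  -- A loop has one orientation but two words encode it, so `n = 1` is separate; neither graph then
  -- ever has a sink.
  by_cases hn : n = 1
  · subst hn
    have hs (G : Graph (Fin 1) (Fin 1)) (hE : G.edgeSet = Set.univ) : sinkMean G f = f 0 := by
      have hE' : 0 ∈ G.edgeSet := hE ▸ Set.mem_univ 0
      have (o : Orientation G) : sinks o = ∅ :=
        isSinkFree_iff.1 fun v hv => hv.2 ⟨0, hE'⟩ (Subsingleton.elim _ _)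
      simp only [sinkMean, this, Finset.card_empty]
      exact sinkMean_const (G := G) (f 0)
    rw [hs _ rfl, hs _ rfl]
  · let l : Fin n := ⟨n - 1, Nat.sub_lt (NeZero.pos n) one_pos⟩
    have hC := sum_sinks hn (G := cycle n) rfl rfl (fun e x => cycle_inc.1) Finset.univ (by
      intro b
      simp only [Finset.mem_univ, true_iff, cycle_inc, tailOf]
      grind)
    have hL := sum_sinks hn (G := lollipop n) rfl rfl (fun e x h => (lollipop_inc.1 h).imp_right
      And.right) (Finset.univ.filter fun b => b l = true) (by
      intro b
      have hl : l.val + 1 = n := Nat.sub_add_cancel (NeZero.pos n)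
      simp only [Finset.mem_filter, Finset.mem_univ, true_and, lollipop_inc, tailOf]
      constructor
      · intro hb e
        by_cases he : e.val + 1 < n
        · grind
        · have : e = l := Fin.ext (by omega)
          simp [this, hb]
      · intro h
        by_contra hb
        have := h l
        simp [hb, hl, add_one_ne_self hn] at this)
    have h2 (f : ℕ → ℝ) : ∑ o : Orientation (cycle n), f (sinks o).card =
        2 * ∑ o : Orientation (lollipop n), f (sinks o).card := by
      rw [hC, hL, sum_sinkCount f l]
    -- The constant function compares the numbers of orientations, so the factor 2 cancels in the
    -- means.
    have hc := h2 fun _ => 1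
    simp only [Finset.sum_const, Finset.card_univ, nsmul_eq_mul, mul_one] at hc
    rw [sinkMean, sinkMean, h2, hc, mul_div_mul_left _ _ two_ne_zero]

end Graphs

end SinkPopping

theorem mainTheorem5 (n : ℕ) [NeZero n]
    (c : SinkPopping.Stacks (SinkPopping.cycle n) → ℕ → Fin n)
    (hc : SinkPopping.IsChoiceRule c)
    (d : SinkPopping.Stacks (SinkPopping.lollipop n) → ℕ → Fin n)
    (hd : SinkPopping.IsChoiceRule d) :
    ProbabilityTheory.IdentDistrib (SinkPopping.numPops c) (SinkPopping.numPops d)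
      (SinkPopping.stackLaw (SinkPopping.cycle n))
      (SinkPopping.stackLaw (SinkPopping.lollipop n)) :=
  SinkPopping.identDistrib_numPops SinkPopping.sinkMean_cycle hc hd
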